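/- Let $\sigma^2>0$, let $C(\mathbb R;\mathbb R)$ carry the topology of uniform convergence on compact sets and its Borel $\sigma$-algebra, and let $F$ be a random element of $C(\mathbb R;\mathbb R)$. Suppose that $F$ is Brownian on compacts with diffusion parameter $\sigma^2$, that is, for all real $y_1<y_2$ the law on $C([y_1,y_2];\mathbb R)$ of $$y\mapsto F(y)-F(y_1),\qquad y\in[y_1,y_2],$$ is absolutely continuous with respect to the law of a Brownian motion on $[y_1,y_2]$ started from $0$ at time $y_1$ with diffusion parameter $\sigma^2$ (the continuous process $B$ with $B(y_1)=0$ and independent increments such that $B(t)-B(s)\sim N(0,\sigma^2(t-s))$ for $s\le t$). Then $F$ is weakly locally Brownian: as $\varepsilon\to0$, the random functions $$F_\varepsilon(t)=\varepsilon^{-1}\bigl(F(\varepsilon^2t)-F(0)\bigr),\qquad t\in\mathbb R,$$ converge in law in $C(\mathbb R;\mathbb R)$ to a two-sided Brownian motion $(B(t))_{t\in\mathbb R}$ with $B(0)=0$ and diffusion parameter $\sigma^2$. -/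

import Mathlib

open MeasureTheory ProbabilityTheory Filter Topology Set
open scoped NNReal

/-- The space `C(X, ℝ)` carries the Borel `σ`-algebra of the compact-open topology, that is, of
uniform convergence on compact sets. -/
instance measurableSpaceContinuousMapReal {X : Type*} [TopologicalSpace X] :
    MeasurableSpace C(X, ℝ) := borel _

instance borelSpaceContinuousMapReal {X : Type*} [TopologicalSpace X] :
    BorelSpace C(X, ℝ) := ⟨rfl⟩

/-- `μ` is the law, on the space of continuous functions on `[y₁, y₂]`, of a Brownian motion
started from `0` at time `y₁` with diffusion parameter `v` (the variance per unit of time). -/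
structure IsBrownianLawOn (v : ℝ≥0) {y₁ y₂ : ℝ} (h : y₁ ≤ y₂) (μ : Measure C(Icc y₁ y₂, ℝ)) :
    Prop where
  start : ∀ᵐ f ∂μ, f ⟨y₁, left_mem_Icc.2 h⟩ = 0
  indep : HasIndepIncrements (fun (t : Icc y₁ y₂) (f : C(Icc y₁ y₂, ℝ)) ↦ f t) μ
  gaussian : ∀ s t : Icc y₁ y₂, s ≤ t →
    HasLaw (fun f : C(Icc y₁ y₂, ℝ) ↦ f t - f s)
      (gaussianReal 0 (v * Real.toNNReal ((t : ℝ) - s))) μ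

/-- `μ` is the law, on the space of continuous functions on the whole line, of a two-sided
Brownian motion `B` with `B 0 = 0` and diffusion parameter `v`. -/
structure IsTwoSidedBrownianLaw (v : ℝ≥0) (μ : Measure C(ℝ, ℝ)) : Prop where
  start : ∀ᵐ f ∂μ, f 0 = 0
  indep : HasIndepIncrements (fun (t : ℝ) (f : C(ℝ, ℝ)) ↦ f t) μ
  gaussian : ∀ s t : ℝ, s ≤ t →
    HasLaw (fun f : C(ℝ, ℝ) ↦ f t - f s) (gaussianReal 0 (v * Real.toNNReal (t - s))) μ

/-- The function `y ↦ f y - f y₁` on `[y₁, y₂]`. -/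
def incrementOn (y₁ y₂ : ℝ) (f : C(ℝ, ℝ)) : C(Icc y₁ y₂, ℝ) where
  toFun y := f y - f y₁
  continuous_toFun := by fun_prop

/-- The function `t ↦ ε⁻¹ (f (ε² t) - f 0)`. -/
noncomputable def rescaleAtZero (ε : ℝ) (f : C(ℝ, ℝ)) : C(ℝ, ℝ) where
  toFun t := ε⁻¹ * (f (ε ^ 2 * t) - f 0)
  continuous_toFun := by fun_prop

/-- The random function `F`, defined on the measure space `(Ω, P)`, is Brownian on compacts with
diffusion parameter `v`: for all `y₁ < y₂` the law of `y ↦ F y - F y₁` on `[y₁, y₂]` is absolutely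
continuous with respect to the law of a Brownian motion started from `(y₁, 0)`. Both laws give full
mass to the closed subspace of the functions that vanish at `y₁`. -/
def BrownianOnCompacts (v : ℝ≥0) {Ω : Type*} [MeasurableSpace Ω] (P : Measure Ω)
    (F : Ω → C(ℝ, ℝ)) : Prop :=
  ∀ (y₁ y₂ : ℝ) (h : y₁ < y₂), ∃ μ : Measure C(Icc y₁ y₂, ℝ),
    IsBrownianLawOn v h.le μ ∧ P.map (fun ω ↦ incrementOn y₁ y₂ (F ω)) ≪ μ

/-- The random function `F` is weakly locally Brownian with diffusion parameter `v`: the random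
functions `t ↦ ε⁻¹ (F (ε² t) - F 0)` converge in law, in `C(ℝ, ℝ)` with the topology of uniform
convergence on compact sets, to a two-sided Brownian motion as `ε → 0`. -/
def WeaklyLocallyBrownian (v : ℝ≥0) {Ω : Type*} [MeasurableSpace Ω] (P : Measure Ω)
    [IsProbabilityMeasure P] (F : Ω → C(ℝ, ℝ)) : Prop :=
  ∃ μ : ProbabilityMeasure C(ℝ, ℝ), IsTwoSidedBrownianLaw v (μ : Measure C(ℝ, ℝ)) ∧
    TendstoInDistribution (fun (ε : ℝ) (ω : Ω) ↦ rescaleAtZero ε (F ω)) (𝓝[≠] 0)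
      (id : C(ℝ, ℝ) → C(ℝ, ℝ)) (fun _ ↦ P) (μ : Measure C(ℝ, ℝ))

/-!
The proof compares `F` with two-sided Brownian motion `W`, for which Brownian scaling makes all the
rescaled paths equal in law (`map_rescaleAtZero`). On `[-1, 1]` the law of `F - F 0` has a density
with respect to that of `W`, and `F` rescaled by a small `ε` depends, on a fixed compact interval,
only on `F` near `0`. So it suffices that the rescaled path of `W` keeps its limit law when the law
of `W` is weighted by a density `ψ`, that is, that `𝔼 [ψ(W) g(W_ε)] → 𝔼 [ψ(W)] 𝔼 [g(W)]`
(`tendsto_integral_mul_rescaleAtZero`).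

This mixing property holds because the germ of `W` at `0` carries no information. Let `ℱ n` be
generated by the increments of `W` outside of `[-1 / (n + 1), 1 / (n + 1)]`. By continuity of paths
the `ℱ n` increase to the `σ`-algebra of all increments, so Lévy's upward theorem approximates `ψ`
in `L¹` by the `ℱ n`-measurable `𝔼[ψ | ℱ n]`; and the rescaled path on `[-K, K]` is independent of
`ℱ n` once `ε² K ≤ 1 / (n + 1)` (`indepFun_stopAt_rescaleAtZero_outerIncrements`). Weak convergence
may be tested on Lipschitz functions for a metric of the uniformity of compact convergence, and
these depend only on the path on a compact interval, up to a uniformly small error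
(`UniformContinuous.isNearlyLocal`); no tightness argument is needed.

The process `W` itself is obtained from the Brownian motion on `[-1, 1]` that the hypothesis
provides: its bridges on `[0, 1]` and `[-1, 0]`, spread over the half-lines by `unfoldBridges`, form
a two-sided Brownian motion. Identities in law and independence are verified on covariances,
which is enough since the processes are centred Gaussian and the Borel `σ`-algebra of `C(ℝ, ℝ)` is
generated by the evaluations (`measurableSpace_continuousMap_eq_comap`).
-/

/-! ### The Borel `σ`-algebra of `C(X, ℝ)` and laws of continuous Gaussian processes -/

section Borel

variable {X : Type*} [TopologicalSpace X] [SecondCountableTopology X]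

/-- A mapping condition on a compact set is a countable combination of conditions on single values:
by compactness `f` maps `K` into the open set `U` if and only if it maps a countable dense subset of
`K` into one of countably many closed sets exhausting `U`. -/
lemma measurableSet_comap_mapsTo {K : Set X} (hK : IsCompact K) {U : Set ℝ} (hU : IsOpen U) :
    MeasurableSet[MeasurableSpace.comap (fun (f : C(X, ℝ)) (x : X) ↦ f x) MeasurableSpace.pi]
      {f : C(X, ℝ) | MapsTo f K U} := by
  let _ : MeasurableSpace C(X, ℝ) :=
    MeasurableSpace.comap (fun (f : C(X, ℝ)) (x : X) ↦ f x) MeasurableSpace.pi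
  have heval (x : X) : Measurable (fun f : C(X, ℝ) ↦ f x) :=
    (measurable_pi_apply x).comp (comap_measurable _)
  obtain ⟨D, hDc, hDd⟩ := TopologicalSpace.exists_countable_dense K
  let C : ℕ → Set ℝ := fun n ↦ {y | ENNReal.ofReal (1 / (n + 1)) ≤ Metric.infEDist y Uᶜ}
  have hC (n : ℕ) : IsClosed (C n) := isClosed_le continuous_const Metric.continuous_infEDist
  have hset : {f : C(X, ℝ) | MapsTo f K U} = ⋃ n, ⋂ x ∈ D, {f : C(X, ℝ) | f x ∈ C n} := by
    ext f
    simp only [mem_ofPred_eq, mem_iUnion, mem_iInter]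
    constructor
    · intro hf
      obtain ⟨δ, hδ, hsub⟩ :=
        (hK.image f.continuous).exists_thickening_subset_open hU hf.image_subset
      obtain ⟨n, hn⟩ := exists_nat_one_div_lt hδ
      refine ⟨n, fun x _ ↦ ?_⟩
      refine Metric.le_infEDist.2 fun y hy ↦ ?_
      by_contra! hlt
      refine hy (hsub (Metric.mem_thickening_iff.2 ⟨f x, mem_image_of_mem _ x.2, ?_⟩))
      rw [edist_dist, ENNReal.ofReal_lt_ofReal_iff (by positivity)] at hlt
      rw [dist_comm]
      exact hlt.trans hn
    · rintro ⟨n, hn⟩ x hx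
      have hcl : ∀ z : K, f z ∈ C n := by
        have : IsClosed {z : K | f z ∈ C n} := (hC n).preimage (by fun_prop)
        exact fun z ↦ (this.closure_subset_iff (s := D)).2 (fun z hz ↦ hn z hz) (hDd z)
      by_contra hxU
      have h0 := hcl ⟨x, hx⟩
      simp only [C, mem_ofPred_eq, Metric.infEDist_zero_of_mem (s := Uᶜ) hxU] at h0
      have : (0 : ℝ) < 1 / (n + 1) := by positivity
      simp only [nonpos_iff_eq_zero, ENNReal.ofReal_eq_zero] at h0
      linarith
  rw [hset]
  exact MeasurableSet.iUnion fun n ↦ MeasurableSet.biInter hDc fun x _ ↦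
    heval x (hC n).measurableSet

variable [LocallyCompactSpace X]

/-- The Borel `σ`-algebra of the compact-open topology is the one generated by the evaluations. -/
lemma measurableSpace_continuousMap_eq_comap :
    (measurableSpaceContinuousMapReal : MeasurableSpace C(X, ℝ)) =
      MeasurableSpace.comap (fun f x ↦ f x) MeasurableSpace.pi := by
  apply le_antisymm
  · change borel C(X, ℝ) ≤ _
    rw [borel_eq_generateFrom_of_subbasis (ContinuousMap.compactOpen_eq (X := X) (Y := ℝ))]
    refine MeasurableSpace.generateFrom_le ?_
    rintro _ ⟨K, hK, U, hU, rfl⟩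
    exact measurableSet_comap_mapsTo hK hU
  · rw [← measurable_iff_comap_le]
    exact measurable_pi_lambda _ fun x ↦ (ContinuousEvalConst.continuous_eval_const x).measurable

lemma measurable_continuousMap_iff {Ω : Type*} [MeasurableSpace Ω] {F : Ω → C(X, ℝ)} :
    Measurable F ↔ ∀ x, Measurable fun ω ↦ F ω x := by
  rw [← measurable_pi_iff, measurableSpace_continuousMap_eq_comap, measurable_comap_iff]
  rfl

/-- Random continuous functions are independent if their families of values are. -/
lemma indepFun_continuousMap {Ω : Type*} {mΩ : MeasurableSpace Ω} {P : Measure Ω}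
    {F G : Ω → C(X, ℝ)} (h : IndepFun (fun ω x ↦ F ω x) (fun ω x ↦ G ω x) P) :
    IndepFun F G P := by
  rw [IndepFun_iff_Indep] at h ⊢
  rw [measurableSpace_continuousMap_eq_comap, MeasurableSpace.comap_comp,
    MeasurableSpace.comap_comp]
  exact h

end Borel

section GaussianLaw

/-- A centred Gaussian vector is determined by its covariances. -/
lemma map_eq_of_hasGaussianLaw_of_covariance {ι Ω Ω' : Type*} [Fintype ι] {mΩ : MeasurableSpace Ω}
    {mΩ' : MeasurableSpace Ω'} {P : Measure Ω} {P' : Measure Ω'} {Y : ι → Ω → ℝ} {Y' : ι → Ω' → ℝ}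
    (hY : HasGaussianLaw (fun ω i ↦ Y i ω) P) (hY' : HasGaussianLaw (fun ω i ↦ Y' i ω) P')
    (hm : ∀ i, P[Y i] = P'[Y' i]) (hc : ∀ i j, cov[Y i, Y j; P] = cov[Y' i, Y' j; P']) :
    P.map (fun ω i ↦ Y i ω) = P'.map (fun ω i ↦ Y' i ω) := by
  apply (MeasurableEquiv.toLp 2 (_ → ℝ)).map_measurableEquiv_injective
  rw [MeasurableEquiv.coe_toLp, ← PiLp.coe_symm_continuousLinearEquiv 2 ℝ]
  have h1 := hY.isGaussian_map
  have h2 := hY'.isGaussian_map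
  have m1 := hY.aemeasurable
  have m2 := hY'.aemeasurable
  apply IsGaussian.ext
  · have hcont := (PiLp.continuousLinearEquiv 2 ℝ fun _ : ι ↦ ℝ).symm.continuous
    rw [integral_map hcont.aemeasurable (by fun_prop),
      integral_map hcont.aemeasurable (by fun_prop)]
    simp only [id_eq]
    rw [integral_map m1 hcont.aestronglyMeasurable, integral_map m2 hcont.aestronglyMeasurable,
      ContinuousLinearEquiv.integral_comp_comm, ContinuousLinearEquiv.integral_comp_comm]
    congr 1
    ext i
    rw [eval_integral fun i ↦ (hY.eval i).integrable,
      eval_integral fun i ↦ (hY'.eval i).integrable]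
    exact hm i
  · rw [← ContinuousLinearMap.toBilinForm_inj]
    refine LinearMap.BilinForm.ext_of_isSymm isPosSemidef_covarianceBilin.isSymm
      isPosSemidef_covarianceBilin.isSymm fun x ↦ ?_
    simp only [ContinuousLinearMap.toBilinForm_apply]
    rw [PiLp.coe_symm_continuousLinearEquiv, covarianceBilin_apply_pi, covarianceBilin_apply_pi]
    · congrm ∑ i, ∑ j, _ * ?_
      rw [covariance_map (measurable_pi_apply i).aestronglyMeasurable
          (measurable_pi_apply j).aestronglyMeasurable m1,
        covariance_map (measurable_pi_apply i).aestronglyMeasurable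
          (measurable_pi_apply j).aestronglyMeasurable m2]
      exact hc i j
    · exact fun i ↦ (h2.hasGaussianLaw_id.eval i).memLp_two
    · exact fun i ↦ (h1.hasGaussianLaw_id.eval i).memLp_two

/-- The law of a continuous Gaussian process is determined by its means and covariances. -/
lemma map_eq_of_isGaussianProcess {X : Type*} [TopologicalSpace X] [SecondCountableTopology X]
    [LocallyCompactSpace X] {Ω Ω' : Type*} {mΩ : MeasurableSpace Ω}
    {mΩ' : MeasurableSpace Ω'} {P : Measure Ω} {P' : Measure Ω'} {F : Ω → C(X, ℝ)}
    {G : Ω' → C(X, ℝ)} (hF : Measurable F) (hG : Measurable G)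
    (hFG : IsGaussianProcess (fun x ω ↦ F ω x) P) (hGG : IsGaussianProcess (fun x ω ↦ G ω x) P')
    (hm : ∀ x, ∫ ω, F ω x ∂P = ∫ ω, G ω x ∂P')
    (hc : ∀ x y, cov[fun ω ↦ F ω x, fun ω ↦ F ω y; P] = cov[fun ω ↦ G ω x, fun ω ↦ G ω y; P']) :
    P.map F = P'.map G := by
  have := hFG.isProbabilityMeasure
  have := hGG.isProbabilityMeasure
  have mF : Measurable fun ω (x : X) ↦ F ω x :=
    measurable_pi_iff.2 (measurable_continuousMap_iff.1 hF)
  have mG : Measurable fun ω (x : X) ↦ G ω x :=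
    measurable_pi_iff.2 (measurable_continuousMap_iff.1 hG)
  have hcoe : Measurable fun (f : C(X, ℝ)) (x : X) ↦ f x :=
    measurable_pi_iff.2 (measurable_continuousMap_iff.1 measurable_id)
  have hpi : P.map (fun ω (x : X) ↦ F ω x) = P'.map (fun ω (x : X) ↦ G ω x) := by
    have h1 := isProjectiveLimit_map (X := fun x ω ↦ F ω x) (P := P) mF.aemeasurable
    have h2 := isProjectiveLimit_map (X := fun x ω ↦ G ω x) (P := P') mG.aemeasurable
    have h3 : (fun I : Finset X ↦ P.map (fun ω ↦ I.restrict (F ω ·))) =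
        fun I : Finset X ↦ P'.map (fun ω ↦ I.restrict (G ω ·)) := by
      funext I
      exact map_eq_of_hasGaussianLaw_of_covariance (Y := fun (i : I) ω ↦ F ω i)
        (Y' := fun (i : I) ω ↦ G ω i) (hFG.hasGaussianLaw I) (hGG.hasGaussianLaw I)
        (fun i ↦ hm i) (fun i j ↦ hc i j)
    rw [h3] at h1
    exact h1.unique h2
  ext s hs
  rw [measurableSpace_continuousMap_eq_comap] at hs
  obtain ⟨t, ht, rfl⟩ := hs
  rw [Measure.map_apply hF (hcoe ht), Measure.map_apply hG (hcoe ht)]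
  have := congrArg (fun m ↦ m t) hpi
  beta_reduce at this
  rwa [Measure.map_apply mF ht, Measure.map_apply mG ht] at this

end GaussianLaw

/-! ### Centred Gaussian processes and their covariances -/

/-- `X` is a centred real Gaussian process with covariance function `k`. -/
structure IsCentredGaussian {T Ω : Type*} {mΩ : MeasurableSpace Ω} (X : T → Ω → ℝ)
    (k : T → T → ℝ) (P : Measure Ω) : Prop where
  gaussian : IsGaussianProcess X P
  mean : ∀ t, ∫ ω, X t ω ∂P = 0
  cov : ∀ s t, cov[X s, X t; P] = k s t

namespace IsCentredGaussian

variable {S T Ω : Type*} {mΩ : MeasurableSpace Ω} {P : Measure Ω} {X : T → Ω → ℝ} {k : T → T → ℝ}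

lemma memLp_two (h : IsCentredGaussian X k P) (t : T) : MemLp (X t) 2 P :=
  (h.gaussian.hasGaussianLaw_eval t).memLp_two

/-- Linear combinations of values of a centred Gaussian process form a centred Gaussian process. -/
lemma sum_mul (h : IsCentredGaussian X k P) {n : ℕ} (a : S → Fin n → ℝ) (τ : S → Fin n → T) :
    IsCentredGaussian (fun s ω ↦ ∑ i, a s i * X (τ s i) ω)
      (fun s t ↦ ∑ i, ∑ j, a s i * a t j * k (τ s i) (τ t j)) P := by
  have := h.gaussian.isProbabilityMeasure
  refine ⟨?_, fun s ↦ ?_, fun s t ↦ ?_⟩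
  · classical
    exact IsGaussianProcess.of_isGaussianProcess h.gaussian fun s ↦ ⟨Finset.univ.image (τ s),
      { toFun x := ∑ i, a s i * x ⟨τ s i, by simp⟩
        map_add' x y := by simp [mul_add, Finset.sum_add_distrib]
        map_smul' c x := by simp [Finset.mul_sum, mul_left_comm] }, fun ω ↦ by simp⟩
  · rw [integral_finsetSum _ fun i _ ↦ ((h.memLp_two _).integrable (by simp)).const_mul _]
    simp [integral_const_mul, h.mean]
  · rw [covariance_fun_sum_fun_sum (fun i ↦ (h.memLp_two _).const_mul _)
      (fun i ↦ (h.memLp_two _).const_mul _)]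
    simp_rw [covariance_const_mul_left, covariance_const_mul_right, h.cov, mul_assoc]

lemma of_eq {Y : T → Ω → ℝ} {l : T → T → ℝ} (h : IsCentredGaussian X k P)
    (hXY : ∀ t ω, X t ω = Y t ω) (hkl : ∀ s t, k s t = l s t) : IsCentredGaussian Y l P := by
  obtain rfl : X = Y := funext₂ hXY
  obtain rfl : k = l := funext₂ hkl
  exact h

/-- Being a centred Gaussian process is a property of the law. -/
lemma of_map {Ω' : Type*} {mΩ' : MeasurableSpace Ω'} {F : Ω → Ω'} (hF : Measurable F)
    {Y : T → Ω' → ℝ} (hY : ∀ t, Measurable (Y t))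
    (h : IsCentredGaussian (fun t ω ↦ Y t (F ω)) k P) : IsCentredGaussian Y k (P.map F) := by
  refine ⟨⟨fun I ↦ ⟨?_⟩⟩, fun t ↦ ?_, fun s t ↦ ?_⟩
  · rw [Measure.map_map (by fun_prop) hF]
    exact (h.gaussian.hasGaussianLaw I).isGaussian_map
  · rw [integral_map hF.aemeasurable (hY t).aestronglyMeasurable]
    exact h.mean t
  · rw [covariance_map (hY s).aestronglyMeasurable (hY t).aestronglyMeasurable hF.aemeasurable]
    exact h.cov s t

end IsCentredGaussian

/-- A law on path space is determined by the covariances of its coordinate process, when the latter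
is centred Gaussian. -/
lemma map_eq_of_isCentredGaussian {X Ω Ω' : Type*} [TopologicalSpace X]
    [SecondCountableTopology X] [LocallyCompactSpace X] {mΩ : MeasurableSpace Ω}
    {mΩ' : MeasurableSpace Ω'} {P : Measure Ω} {P' : Measure Ω'} {F : Ω → C(X, ℝ)}
    {G : Ω' → C(X, ℝ)} {k : X → X → ℝ} (mF : Measurable F) (mG : Measurable G)
    (hF : IsCentredGaussian (fun x ω ↦ F ω x) k P)
    (hG : IsCentredGaussian (fun x ω ↦ G ω x) k P') : P.map F = P'.map G :=
  map_eq_of_isGaussianProcess mF mG hF.gaussian hG.gaussian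
    (fun x ↦ (hF.mean x).trans (hG.mean x).symm) fun x y ↦ (hF.cov x y).trans (hG.cov x y).symm

/-! ### Brownian covariances -/

/-- The covariance function of two-sided Brownian motion with unit diffusion parameter: it is
`min |s| |t|` if `s` and `t` have the same sign, and `0` otherwise. -/
noncomputable def brownianKernel (s t : ℝ) : ℝ := (|s| + |t| - |s - t|) / 2

@[simp] lemma brownianKernel_zero_left (t : ℝ) : brownianKernel 0 t = 0 := by
  simp [brownianKernel]

@[simp] lemma brownianKernel_zero_right (t : ℝ) : brownianKernel t 0 = 0 := by
  simp [brownianKernel]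

lemma brownianKernel_comm (s t : ℝ) : brownianKernel s t = brownianKernel t s := by
  simp [brownianKernel, abs_sub_comm, add_comm]

lemma brownianKernel_neg_neg (s t : ℝ) : brownianKernel (-s) (-t) = brownianKernel s t := by
  rw [brownianKernel, brownianKernel, ← abs_neg (s - t), abs_neg, abs_neg]
  ring_nf

lemma brownianKernel_of_le {s t : ℝ} (hs : 0 ≤ s) (hst : s ≤ t) : brownianKernel s t = s := by
  rw [brownianKernel, abs_of_nonneg hs, abs_of_nonneg (hs.trans hst), abs_of_nonpos (by linarith)]
  ring

lemma brownianKernel_of_nonpos_of_nonneg {s t : ℝ} (hs : s ≤ 0) (ht : 0 ≤ t) :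
    brownianKernel s t = 0 := by
  rw [brownianKernel, abs_of_nonpos hs, abs_of_nonneg ht, abs_of_nonpos (by linarith)]
  ring

lemma brownianKernel_of_nonneg_of_nonpos {s t : ℝ} (hs : 0 ≤ s) (ht : t ≤ 0) :
    brownianKernel s t = 0 := by
  rw [brownianKernel_comm, brownianKernel_of_nonpos_of_nonneg ht hs]

lemma brownianKernel_mul {c : ℝ} (hc : 0 ≤ c) (s t : ℝ) :
    brownianKernel (c * s) (c * t) = c * brownianKernel s t := by
  simp only [brownianKernel, ← mul_sub, abs_mul, abs_of_nonneg hc]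
  ring

lemma measurable_coordinate {X : Type*} [TopologicalSpace X] (x : X) :
    Measurable fun f : C(X, ℝ) ↦ f x :=
  (ContinuousEvalConst.continuous_eval_const x).measurable

/-- A Brownian motion on `[y₁, y₂]` started from `0` is centred Gaussian. -/
lemma IsBrownianLawOn.isCentredGaussian {v : ℝ≥0} {y₁ y₂ : ℝ} {h : y₁ ≤ y₂}
    {μ : Measure C(Icc y₁ y₂, ℝ)} (hμ : IsBrownianLawOn v h μ) :
    IsCentredGaussian (fun (t : Icc y₁ y₂) (f : C(Icc y₁ y₂, ℝ)) ↦ f t)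
      (fun s t ↦ v * (min (s : ℝ) t - y₁)) μ := by
  let _ : OrderBot (Icc y₁ y₂) :=
    { bot := ⟨y₁, left_mem_Icc.2 h⟩
      bot_le := fun t ↦ t.2.1 }
  have law (t : Icc y₁ y₂) : HasLaw (fun f : C(Icc y₁ y₂, ℝ) ↦ f t)
      (gaussianReal 0 (v * Real.toNNReal ((t : ℝ) - y₁))) μ := by
    refine (hμ.gaussian ⊥ t bot_le).congr ?_
    filter_upwards [hμ.start] with f hf
    change f t = f t - f ⟨y₁, _⟩
    rw [hf, sub_zero]
  have hp := (law ⊥).isProbabilityMeasure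
  have hL (t : Icc y₁ y₂) := (law t).hasGaussianLaw.memLp_two
  have hcov (s t : Icc y₁ y₂) (hst : s ≤ t) :
      cov[fun f : C(Icc y₁ y₂, ℝ) ↦ f s, fun f : C(Icc y₁ y₂, ℝ) ↦ f t; μ] =
        v * (s - y₁) := by
    have hind := hμ.indep.indepFun_eval_sub (r := ⊥) bot_le hst hμ.start
    have hdec : (fun f : C(Icc y₁ y₂, ℝ) ↦ f t) =
        ((fun f : C(Icc y₁ y₂, ℝ) ↦ f t) - fun f ↦ f s) + fun f ↦ f s := by simp
    rw [hdec, covariance_add_right (hL s) ((hL t).sub (hL s)) (hL s),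
      hind.covariance_eq_zero (hL s) ((hL t).sub (hL s)), covariance_self (law s).aemeasurable,
      (law s).variance_eq, variance_id_gaussianReal]
    simp [Real.coe_toNNReal _ (sub_nonneg.2 s.2.1)]
  refine ⟨hμ.indep.isGaussianProcess (fun t ↦ (law t).hasGaussianLaw) hμ.start, fun t ↦ ?_,
    fun s t ↦ ?_⟩
  · rw [(law t).integral_eq, integral_id_gaussianReal]
  · rcases le_total s t with hst | hst
    · rw [hcov s t hst, min_eq_left (Subtype.coe_le_coe.2 hst)]
    · rw [covariance_comm, hcov t s hst, min_eq_right (Subtype.coe_le_coe.2 hst)]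

/-- The Gaussian characterization of two-sided Brownian motion. -/
lemma isTwoSidedBrownianLaw_of_isCentredGaussian {v : ℝ≥0} {μ : Measure C(ℝ, ℝ)}
    (hμ : IsCentredGaussian (fun (t : ℝ) (f : C(ℝ, ℝ)) ↦ f t)
      (fun s t ↦ v * brownianKernel s t) μ) : IsTwoSidedBrownianLaw v μ := by
  have hp := hμ.gaussian.isProbabilityMeasure
  have law (s t : ℝ) (hst : s ≤ t) :
      HasLaw (fun f : C(ℝ, ℝ) ↦ f t - f s) (gaussianReal 0 (v * Real.toNNReal (t - s))) μ := by
    have hg : HasGaussianLaw (fun f : C(ℝ, ℝ) ↦ f t - f s) μ := hμ.gaussian.hasGaussianLaw_fun_sub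
    refine ⟨hg.aemeasurable, ?_⟩
    rw [hg.map_eq_gaussianReal]
    congr 1
    · rw [integral_sub ((hμ.memLp_two t).integrable (by simp))
        ((hμ.memLp_two s).integrable (by simp)), hμ.mean, hμ.mean, sub_zero]
    · rw [variance_fun_sub (hμ.memLp_two t) (hμ.memLp_two s),
        ← covariance_self (hμ.gaussian.aemeasurable t),
        ← covariance_self (hμ.gaussian.aemeasurable s), hμ.cov, hμ.cov, hμ.cov]
      have hk : v * brownianKernel t t - 2 * (v * brownianKernel t s) + v * brownianKernel s s =
          v * (t - s) := by
        simp only [brownianKernel, sub_self, abs_zero, abs_of_nonneg (sub_nonneg.2 hst)]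
        ring
      rw [hk, Real.toNNReal_mul v.coe_nonneg, Real.toNNReal_coe]
  refine ⟨?_, ?_, law⟩
  · have h0 : HasLaw (fun f : C(ℝ, ℝ) ↦ f 0) (gaussianReal 0 0) μ := by
      have hg : HasGaussianLaw (fun f : C(ℝ, ℝ) ↦ f 0) μ := hμ.gaussian.hasGaussianLaw_eval 0
      refine ⟨hg.aemeasurable, ?_⟩
      rw [hg.map_eq_gaussianReal, hμ.mean, ← covariance_self hg.aemeasurable, hμ.cov]
      simp
    rw [gaussianReal_zero_var] at h0
    exact h0.ae_eq_of_dirac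
  · refine fun n t ht ↦ hμ.gaussian.hasGaussianLaw_increments.iIndepFun_of_covariance_eq_zero
      fun i j hij ↦ ?_
    rw [covariance_fun_sub_fun_sub (hμ.memLp_two _) (hμ.memLp_two _) (hμ.memLp_two _)
      (hμ.memLp_two _)]
    simp_rw [hμ.cov]
    -- The increments over `[a, b]` and `[c, d]` are uncorrelated.
    have key {a b c d : ℝ} (hab : a ≤ b) (hbc : b ≤ c) (hcd : c ≤ d) :
        brownianKernel b d - brownianKernel b c - brownianKernel a d + brownianKernel a c = 0 := by
      simp only [brownianKernel, abs_of_nonpos (sub_nonpos.2 (hbc.trans hcd)),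
        abs_of_nonpos (sub_nonpos.2 hbc), abs_of_nonpos (sub_nonpos.2 (hab.trans hbc)),
        abs_of_nonpos (sub_nonpos.2 ((hab.trans hbc).trans hcd))]
      ring
    rcases lt_or_gt_of_ne hij with hlt | hlt
    · have := key (ht (Fin.castSucc_le_succ i)) (ht (Fin.succ_le_castSucc_iff.2 hlt))
        (ht (Fin.castSucc_le_succ j))
      linear_combination (v : ℝ) * this
    · have := key (ht (Fin.castSucc_le_succ j)) (ht (Fin.succ_le_castSucc_iff.2 hlt))
        (ht (Fin.castSucc_le_succ i))
      rw [brownianKernel_comm (t i.succ), brownianKernel_comm (t i.castSucc),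
        brownianKernel_comm (t i.succ), brownianKernel_comm (t i.castSucc)]
      linear_combination (v : ℝ) * this

/-! ### Construction of two-sided Brownian motion -/

/-- The point of `[-K, K]` closest to `t`, for `0 ≤ K`. -/
def clampAt (K t : ℝ) : ℝ := max (-K) (min K t)

lemma continuous_clampAt (K : ℝ) : Continuous (clampAt K) := by
  unfold clampAt
  fun_prop

lemma abs_clampAt_le {K : ℝ} (hK : 0 ≤ K) (t : ℝ) : |clampAt K t| ≤ K :=
  abs_le.2 ⟨le_max_left _ _, max_le (by linarith) (min_le_left _ _)⟩

lemma clampAt_of_abs_le {K t : ℝ} (ht : |t| ≤ K) : clampAt K t = t := by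
  rw [abs_le] at ht
  rw [clampAt, min_eq_right ht.2, max_eq_right ht.1]

/-- The path `f`, recentred at time `0` and frozen outside of `[-1, 1]`. -/
def stopCentred (f : C(ℝ, ℝ)) : C(ℝ, ℝ) where
  toFun t := f (clampAt 1 t) - f 0
  continuous_toFun := by
    have := continuous_clampAt 1
    fun_prop

/-- The extension to the whole line of a path on `[-1, 1]`, recentred at time `0` and constant on
`(-∞, -1]` and on `[1, ∞)`. -/
noncomputable def extendCentred (f : C(Icc (-1 : ℝ) 1, ℝ)) : C(ℝ, ℝ) where
  toFun t := f (projIcc (-1) 1 (by norm_num) t) - f ⟨0, by norm_num⟩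
  continuous_toFun := by fun_prop

lemma measurable_extendCentred : Measurable extendCentred :=
  measurable_continuousMap_iff.2 fun _ ↦
    (measurable_coordinate _).sub (measurable_coordinate _)

lemma measurable_stopCentred : Measurable stopCentred :=
  measurable_continuousMap_iff.2 fun _ ↦
    (measurable_coordinate _).sub (measurable_coordinate _)

lemma measurable_incrementOn (y₁ y₂ : ℝ) : Measurable (incrementOn y₁ y₂) :=
  measurable_continuousMap_iff.2 fun _ ↦
    (measurable_coordinate _).sub (measurable_coordinate _)

lemma measurable_rescaleAtZero (ε : ℝ) : Measurable (rescaleAtZero ε) :=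
  measurable_continuousMap_iff.2 fun _ ↦
    ((measurable_coordinate _).sub (measurable_coordinate _)).const_mul _

lemma extendCentred_incrementOn (f : C(ℝ, ℝ)) :
    extendCentred (incrementOn (-1) 1 f) = stopCentred f := by
  ext t
  simp [extendCentred, incrementOn, stopCentred, clampAt, coe_projIcc]

/-- Brownian motion on `[-1, 1]`, recentred at time `0` and frozen outside of `[-1, 1]`, has the
covariances of two-sided Brownian motion frozen outside of `[-1, 1]`. -/
lemma IsBrownianLawOn.isCentredGaussian_extendCentred {v : ℝ≥0} {h : (-1 : ℝ) ≤ 1}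
    {μ : Measure C(Icc (-1 : ℝ) 1, ℝ)} (hμ : IsBrownianLawOn v h μ) :
    IsCentredGaussian (fun (t : ℝ) (f : C(ℝ, ℝ)) ↦ f t)
      (fun s t ↦ v * brownianKernel (clampAt 1 s) (clampAt 1 t)) (μ.map extendCentred) := by
  refine .of_map measurable_extendCentred measurable_coordinate ?_
  refine (hμ.isCentredGaussian.sum_mul (fun _ : ℝ ↦ ![1, -1])
    fun t ↦ ![projIcc (-1) 1 h t, ⟨0, by norm_num⟩]).of_eq (fun t f ↦ ?_) (fun s t ↦ ?_)
  · simp [extendCentred, sub_eq_add_neg]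
  · have hcl (t : ℝ) : (projIcc (-1) 1 h t : ℝ) = clampAt 1 t := coe_projIcc _ _ _ _
    simp only [Fin.sum_univ_two, Matrix.cons_val_zero, Matrix.cons_val_one, hcl]
    generalize clampAt 1 s = a
    generalize clampAt 1 t = b
    rw [brownianKernel, min_self, min_def, min_def, min_def]
    split_ifs <;> cases abs_cases a <;> cases abs_cases b <;> cases abs_cases (a - b) <;> grind

/-- The transformation of a path on `[-1, 1]` vanishing at `0` that turns two-sided Brownian motion
on `[-1, 1]` into two-sided Brownian motion on the whole line: the bridges of the path on `[0, 1]`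
and on `[-1, 0]` are spread over the half-lines. For `t ≥ 0` it is
`(1 + t) (f (t / (1 + t)) - t / (1 + t) * f 1)`. -/
noncomputable def unfoldBridges (f : C(ℝ, ℝ)) : C(ℝ, ℝ) where
  toFun t := (1 + |t|) * f (t / (1 + |t|)) - max t 0 * f 1 - max (-t) 0 * f (-1)
  continuous_toFun := by
    have (t : ℝ) : 1 + |t| ≠ 0 := by positivity
    have : Continuous fun t : ℝ ↦ t / (1 + |t|) := by fun_prop (disch := assumption)
    fun_prop

lemma measurable_unfoldBridges : Measurable unfoldBridges :=
  measurable_continuousMap_iff.2 fun _ ↦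
    (((measurable_coordinate _).const_mul _).sub ((measurable_coordinate _).const_mul _)).sub
      ((measurable_coordinate _).const_mul _)

lemma brownianKernel_one_right {t : ℝ} (ht : t ≤ 1) : brownianKernel t 1 = max t 0 := by
  rcases le_total 0 t with h | h
  · rw [brownianKernel_of_le h ht, max_eq_left h]
  · rw [brownianKernel_of_nonpos_of_nonneg h zero_le_one, max_eq_right h]

lemma brownianKernel_neg_one_right {t : ℝ} (ht : -1 ≤ t) :
    brownianKernel t (-1) = max (-t) 0 := by
  rw [← brownianKernel_neg_neg, neg_neg, brownianKernel_one_right (by linarith)]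

/-- The covariances of the time-changed path `(1 + |t|) f (t / (1 + |t|))`, before the
correction that makes bridges of the two halves of `f`. -/
lemma mul_brownianKernel_div (s t : ℝ) :
    (1 + |s|) * (1 + |t|) * brownianKernel (s / (1 + |s|)) (t / (1 + |t|)) =
      brownianKernel s t + max s 0 * max t 0 + max (-s) 0 * max (-t) 0 := by
  have hs : 0 < 1 + |s| := by positivity
  have ht : 0 < 1 + |t| := by positivity
  have key : (1 + |s|) * (1 + |t|) * brownianKernel (s / (1 + |s|)) (t / (1 + |t|)) =
      brownianKernel (s * (1 + |t|)) (t * (1 + |s|)) := by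
    rw [← brownianKernel_mul (by positivity)]
    congr 1 <;> field_simp
  rw [key, brownianKernel, brownianKernel, abs_mul, abs_mul, abs_of_pos hs, abs_of_pos ht]
  rcases le_total 0 s with h | h <;> rcases le_total 0 t with h' | h'
  · rw [abs_of_nonneg h, abs_of_nonneg h', max_eq_left h, max_eq_left h',
      max_eq_right (neg_nonpos.2 h), show s * (1 + t) - t * (1 + s) = s - t by ring]
    ring
  · rw [abs_of_nonneg h, abs_of_nonpos h', max_eq_left h, max_eq_right h',
      max_eq_right (neg_nonpos.2 h), abs_of_nonneg (by nlinarith), abs_of_nonneg (by linarith)]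
    ring
  · rw [abs_of_nonpos h, abs_of_nonneg h', max_eq_right h, max_eq_left h',
      max_eq_right (neg_nonpos.2 h'), abs_of_nonpos (by nlinarith), abs_of_nonpos (by linarith)]
    ring
  · rw [abs_of_nonpos h, abs_of_nonpos h', max_eq_right h,
      max_eq_left (neg_nonneg.2 h), max_eq_left (neg_nonneg.2 h'),
      show s * (1 + -t) - t * (1 + -s) = s - t by ring]
    ring

/-- Brownian motion on `[-1, 1]` unfolds to two-sided Brownian motion on the whole line. -/
lemma isCentredGaussian_unfoldBridges {v : ℝ≥0} {m : Measure C(ℝ, ℝ)}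
    (hm : IsCentredGaussian (fun (t : ℝ) (f : C(ℝ, ℝ)) ↦ f t)
      (fun s t ↦ v * brownianKernel (clampAt 1 s) (clampAt 1 t)) m) :
    IsCentredGaussian (fun (t : ℝ) (f : C(ℝ, ℝ)) ↦ f t)
      (fun s t ↦ v * brownianKernel s t) (m.map unfoldBridges) := by
  refine .of_map measurable_unfoldBridges measurable_coordinate ?_
  refine (hm.sum_mul (fun t : ℝ ↦ ![1 + |t|, -max t 0, -max (-t) 0])
    fun t ↦ ![t / (1 + |t|), 1, -1]).of_eq (fun t f ↦ ?_) (fun s t ↦ ?_)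
  · simp [unfoldBridges, Fin.sum_univ_three, sub_eq_add_neg]
  · have hp (t : ℝ) : 0 < 1 + |t| := by positivity
    have hle (t : ℝ) : |t / (1 + |t|)| ≤ 1 := by
      rw [abs_div, abs_of_pos (hp t), div_le_one (hp t)]
      linarith
    have h1 (t : ℝ) : (1 + |t|) * brownianKernel (t / (1 + |t|)) 1 = max t 0 := by
      rw [brownianKernel_one_right (abs_le.1 (hle t)).2, mul_max_of_nonneg _ _ (hp t).le,
        mul_div_cancel₀ _ (hp t).ne', mul_zero]
    have h2 (t : ℝ) : (1 + |t|) * brownianKernel (t / (1 + |t|)) (-1) = max (-t) 0 := by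
      rw [brownianKernel_neg_one_right (abs_le.1 (hle t)).1, mul_max_of_nonneg _ _ (hp t).le,
        mul_neg, mul_div_cancel₀ _ (hp t).ne', mul_zero]
    have h3 : brownianKernel 1 1 = 1 := brownianKernel_of_le zero_le_one le_rfl
    have h4 : brownianKernel (-1) (-1) = 1 := by rw [brownianKernel_neg_neg, h3]
    have h5 : brownianKernel 1 (-1) = 0 :=
      brownianKernel_of_nonneg_of_nonpos zero_le_one (by norm_num)
    have h6 : brownianKernel (-1) 1 = 0 := by rw [brownianKernel_comm, h5]
    simp only [Fin.sum_univ_three, Matrix.cons_val_zero, Matrix.cons_val_one, Matrix.cons_val,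
      clampAt_of_abs_le (hle _), clampAt_of_abs_le (abs_one (α := ℝ)).le,
      clampAt_of_abs_le (show |(-1 : ℝ)| ≤ 1 by simp), h3, h4, h5, h6]
    rw [brownianKernel_comm 1, brownianKernel_comm (-1)]
    linear_combination (v : ℝ) * (mul_brownianKernel_div s t - max t 0 * h1 s - max s 0 * h1 t
      - max (-t) 0 * h2 s - max (-s) 0 * h2 t)

/-! ### Invariance and independence properties of two-sided Brownian motion -/

lemma isCentredGaussian_stopCentred {v : ℝ≥0} {μ : Measure C(ℝ, ℝ)}
    (hμ : IsCentredGaussian (fun (t : ℝ) (f : C(ℝ, ℝ)) ↦ f t)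
      (fun s t ↦ v * brownianKernel s t) μ) :
    IsCentredGaussian (fun (t : ℝ) (f : C(ℝ, ℝ)) ↦ f t)
      (fun s t ↦ v * brownianKernel (clampAt 1 s) (clampAt 1 t)) (μ.map stopCentred) := by
  refine .of_map measurable_stopCentred measurable_coordinate ?_
  refine (hμ.sum_mul (fun _ : ℝ ↦ ![1, -1]) fun t ↦ ![clampAt 1 t, 0]).of_eq
    (fun t f ↦ ?_) (fun s t ↦ ?_)
  · simp [stopCentred, sub_eq_add_neg]
  · simp

/-- Brownian scaling. -/
lemma map_rescaleAtZero {v : ℝ≥0} {μ : Measure C(ℝ, ℝ)}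
    (hμ : IsCentredGaussian (fun (t : ℝ) (f : C(ℝ, ℝ)) ↦ f t)
      (fun s t ↦ v * brownianKernel s t) μ) {ε : ℝ} (hε : ε ≠ 0) : μ.map (rescaleAtZero ε) = μ := by
  conv_rhs => rw [← Measure.map_id (μ := μ)]
  refine map_eq_of_isCentredGaussian (measurable_rescaleAtZero ε) measurable_id ?_ hμ
  refine (hμ.sum_mul (fun _ : ℝ ↦ ![ε⁻¹, -ε⁻¹]) fun t ↦ ![ε ^ 2 * t, 0]).of_eq
    (fun t f ↦ ?_) (fun s t ↦ ?_)
  · simp [rescaleAtZero, mul_add, sub_eq_add_neg]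
  · simp [brownianKernel_mul (sq_nonneg ε)]
    field_simp

/-- The path `f` with its values on `[-δ, δ]` forgotten: it collects the increments of `f` over the
intervals `[δ, t]` and `[t, -δ]`. -/
def outerIncrements (δ : ℝ) (f : C(ℝ, ℝ)) : C(ℝ, ℝ) where
  toFun t := f (max t δ) - f δ + (f (min t (-δ)) - f (-δ))
  continuous_toFun := by fun_prop

/-- The path `f` on `[-K, K]`, extended by constants. -/
def stopAt (K : ℝ) (f : C(ℝ, ℝ)) : C(ℝ, ℝ) where
  toFun t := f (clampAt K t)
  continuous_toFun := by
    have := continuous_clampAt K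
    fun_prop

lemma measurable_outerIncrements (δ : ℝ) : Measurable (outerIncrements δ) :=
  measurable_continuousMap_iff.2 fun _ ↦
    ((measurable_coordinate _).sub (measurable_coordinate _)).add
      ((measurable_coordinate _).sub (measurable_coordinate _))

lemma measurable_stopAt (K : ℝ) : Measurable (stopAt K) :=
  measurable_continuousMap_iff.2 fun _ ↦ measurable_coordinate _

/-- Two-sided Brownian motion on a neighbourhood of `0`, rescaled, is independent of its increments
away from `0`. -/
lemma indepFun_stopAt_rescaleAtZero_outerIncrements {v : ℝ≥0} {μ : Measure C(ℝ, ℝ)}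
    (hμ : IsCentredGaussian (fun (t : ℝ) (f : C(ℝ, ℝ)) ↦ f t)
      (fun s t ↦ v * brownianKernel s t) μ) {K ε δ : ℝ} (hK : 0 ≤ K) (hδ : 0 ≤ δ)
    (hε : ε ^ 2 * K ≤ δ) :
    IndepFun (fun f ↦ stopAt K (rescaleAtZero ε f)) (outerIncrements δ) μ := by
  have hjoint := hμ.sum_mul (S := ℝ ⊕ ℝ)
    (Sum.elim (fun _ ↦ ![ε⁻¹, -ε⁻¹, 0, 0]) fun _ ↦ ![1, -1, 1, -1])
    (Sum.elim (fun s ↦ ![ε ^ 2 * clampAt K s, 0, 0, 0])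
      fun t ↦ ![max t δ, δ, min t (-δ), -δ])
  refine indepFun_continuousMap (IsGaussianProcess.indepFun_of_covariance_eq_zero
    (X := fun s f ↦ stopAt K (rescaleAtZero ε f) s) (Y := fun t f ↦ outerIncrements δ f t)
    ?_ (fun s ↦ ?_) (fun t ↦ ?_) fun s t ↦ ?_)
  · refine hjoint.gaussian.congr fun t ↦ .of_forall fun f ↦ ?_
    rcases t with t | t
    · simp [Fin.sum_univ_four, stopAt, rescaleAtZero, mul_add, sub_eq_add_neg]
    · simp [Fin.sum_univ_four, outerIncrements, sub_eq_add_neg, add_assoc]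
  · exact ((measurable_coordinate s).comp
      ((measurable_stopAt K).comp (measurable_rescaleAtZero ε))).aemeasurable
  · exact ((measurable_coordinate t).comp (measurable_outerIncrements δ)).aemeasurable
  · have hc := hjoint.cov (Sum.inl s) (Sum.inr t)
    have hs : |ε ^ 2 * clampAt K s| ≤ δ := by
      rw [abs_mul, abs_of_nonneg (sq_nonneg ε)]
      exact (mul_le_mul_of_nonneg_left (abs_clampAt_le hK s) (sq_nonneg ε)).trans hε
    obtain ⟨hs1, hs2⟩ := abs_le.1 hs
    have e1 : brownianKernel (ε ^ 2 * clampAt K s) (max t δ) =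
        brownianKernel (ε ^ 2 * clampAt K s) δ := by
      simp only [brownianKernel, abs_of_nonneg hδ, abs_of_nonneg (hδ.trans (le_max_right t δ)),
        abs_of_nonpos (sub_nonpos.2 hs2),
        abs_of_nonpos (sub_nonpos.2 (hs2.trans (le_max_right t δ)))]
      ring
    have e2 : brownianKernel (ε ^ 2 * clampAt K s) (min t (-δ)) =
        brownianKernel (ε ^ 2 * clampAt K s) (-δ) := by
      have h1 := min_le_right t (-δ)
      simp only [brownianKernel, abs_of_nonpos (neg_nonpos.2 hδ), abs_of_nonpos
        (h1.trans (neg_nonpos.2 hδ)), abs_of_nonneg (sub_nonneg.2 hs1),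
        abs_of_nonneg (sub_nonneg.2 (h1.trans hs1))]
      ring
    convert hc using 1
    · congr 1 <;> ext f
      · simp [Fin.sum_univ_four, stopAt, rescaleAtZero, mul_add, sub_eq_add_neg]
      · simp [Fin.sum_univ_four, outerIncrements, sub_eq_add_neg, add_assoc]
    · simp [Fin.sum_univ_four, e1, e2]

/-! ### Mixing of the rescaled Brownian motion -/

/-- Increments outside of `[-δ, δ]` determine those outside of a larger interval. -/
lemma outerIncrements_outerIncrements {δ δ' : ℝ} (hδ : 0 ≤ δ) (hδ' : δ ≤ δ') (f : C(ℝ, ℝ)) :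
    outerIncrements δ' (outerIncrements δ f) = outerIncrements δ' f := by
  have hpos {t : ℝ} (ht : δ ≤ t) : outerIncrements δ f t = f t - f δ := by
    change f (max t δ) - f δ + (f (min t (-δ)) - f (-δ)) = _
    rw [max_eq_left ht, min_eq_right (by linarith)]
    ring
  have hneg {t : ℝ} (ht : t ≤ -δ) : outerIncrements δ f t = f t - f (-δ) := by
    change f (max t δ) - f δ + (f (min t (-δ)) - f (-δ)) = _
    rw [max_eq_right (by linarith), min_eq_left ht]
    ring
  ext t
  change outerIncrements δ f (max t δ') - outerIncrements δ f δ' +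
    (outerIncrements δ f (min t (-δ')) - outerIncrements δ f (-δ')) =
    f (max t δ') - f δ' + (f (min t (-δ')) - f (-δ'))
  rw [hpos (hδ'.trans (le_max_right _ _)), hpos hδ',
    hneg ((min_le_right _ _).trans (neg_le_neg hδ')), hneg (neg_le_neg hδ')]
  ring

/-- The filtration whose `n`-th `σ`-algebra is generated by the increments of the path outside of
`[-1 / (n + 1), 1 / (n + 1)]`. -/
noncomputable def outerFiltration : Filtration ℕ (measurableSpaceContinuousMapReal (X := ℝ)) where
  seq n := MeasurableSpace.comap (outerIncrements (1 / (n + 1))) measurableSpaceContinuousMapReal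
  mono' m n hmn := by
    rintro _ ⟨s, hs, rfl⟩
    refine ⟨_, measurable_outerIncrements (1 / (m + 1)) hs, ?_⟩
    ext f
    rw [mem_preimage, mem_preimage, mem_preimage, outerIncrements_outerIncrements (by positivity)
      (Nat.one_div_le_one_div hmn)]
  le' n := (measurable_outerIncrements _).comap_le

/-- The path `f` recentred at time `0`. -/
def recentre (f : C(ℝ, ℝ)) : C(ℝ, ℝ) where
  toFun t := f t - f 0
  continuous_toFun := by fun_prop

/-- The increments away from `0` determine all increments, since paths are continuous at `0`. -/
lemma measurable_recentre_iSup_outerFiltration :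
    Measurable[⨆ n, outerFiltration n] recentre := by
  refine (@measurable_continuousMap_iff ℝ _ _ _ _ (⨆ n, outerFiltration n) recentre).2 fun t ↦ ?_
  refine @measurable_of_tendsto_metrizable _ _ (⨆ n, outerFiltration n) _ _ _ _
    (fun n f ↦ outerIncrements (1 / ((n : ℝ) + 1)) f t) _ (fun n ↦ ?_) ?_
  · exact ((measurable_coordinate t).comp (comap_measurable _)).mono (le_iSup outerFiltration n)
      le_rfl
  · refine tendsto_pi_nhds.2 fun f ↦ ?_
    have h0 : Tendsto (fun n : ℕ ↦ 1 / ((n : ℝ) + 1)) atTop (𝓝 0) :=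
      tendsto_one_div_add_atTop_nhds_zero_nat
    have hc : Continuous fun δ ↦ f (max t δ) - f δ + (f (min t (-δ)) - f (-δ)) := by fun_prop
    have hlim : f (max t 0) - f 0 + (f (min t (-0)) - f (-0)) = f t - f 0 := by
      rcases le_total 0 t with h | h <;> simp [h]
    have := (hc.tendsto 0).comp h0
    rw [hlim] at this
    exact this

/-- The function `g` of the path depends, up to an arbitrarily small uniform error, only on the path
on a compact interval. -/
def IsNearlyLocal (g : C(ℝ, ℝ) → ℝ) : Prop :=
  ∀ η > 0, ∃ K ≥ 0, ∀ f, |g f - g (stopAt K f)| ≤ η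

/-- Mixing: the rescaled path is asymptotically independent of any fixed integrable function `ψ` of
the increments of the path. -/
lemma tendsto_integral_mul_rescaleAtZero {v : ℝ≥0} {μ : Measure C(ℝ, ℝ)}
    (hμ : IsCentredGaussian (fun (t : ℝ) (f : C(ℝ, ℝ)) ↦ f t)
      (fun s t ↦ v * brownianKernel s t) μ) {ψ g : C(ℝ, ℝ) → ℝ} (hψ : Integrable ψ μ)
    (mψ : Measurable ψ) (hψc : ∀ f, ψ (recentre f) = ψ f) (mg : Measurable g) {M : ℝ}
    (hM : ∀ f, |g f| ≤ M) (hg : IsNearlyLocal g) :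
    Tendsto (fun ε ↦ ∫ f, ψ f * g (rescaleAtZero ε f) ∂μ) (𝓝[≠] 0)
      (𝓝 ((∫ f, ψ f ∂μ) * ∫ f, g f ∂μ)) := by
  have := hμ.gaussian.isProbabilityMeasure
  have mψ' : StronglyMeasurable[⨆ n, outerFiltration n] ψ := by
    have : ψ = ψ ∘ recentre := funext fun f ↦ (hψc f).symm
    rw [this]
    exact (mψ.comp measurable_recentre_iSup_outerFiltration).stronglyMeasurable
  have hM0 : 0 ≤ M := (abs_nonneg _).trans (hM 0)
  have hbdd {h : C(ℝ, ℝ) → ℝ} (mh : Measurable h) (hh : ∀ f, |h f| ≤ M) : Integrable h μ :=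
    .of_bound mh.aestronglyMeasurable M (.of_forall hh)
  have hmul {φ h : C(ℝ, ℝ) → ℝ} (hφ : Integrable φ μ) (mh : Measurable h) (hh : ∀ f, |h f| ≤ M) :
      Integrable (fun f ↦ φ f * h f) μ :=
    hφ.mul_bdd (c := M) mh.aestronglyMeasurable (.of_forall hh)
  -- The error terms below add up to a constant times `η`.
  suffices H : ∀ η > 0, ∀ᶠ ε in 𝓝[≠] (0 : ℝ),
      |∫ f, ψ f * g (rescaleAtZero ε f) ∂μ - (∫ f, ψ f ∂μ) * ∫ f, g f ∂μ| ≤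
        (2 * ∫ f, |ψ f| ∂μ + M) * η by
    refine Metric.tendsto_nhds.2 fun e he ↦ ?_
    have hC : 0 ≤ 2 * ∫ f, |ψ f| ∂μ + M := by
      have : 0 ≤ ∫ f, |ψ f| ∂μ := integral_nonneg fun f ↦ abs_nonneg _
      positivity
    filter_upwards [H (e / (2 * ∫ f, |ψ f| ∂μ + M + 1)) (by positivity)] with ε hε
    rw [Real.dist_eq]
    refine hε.trans_lt ?_
    rw [mul_div_assoc', div_lt_iff₀ (by positivity)]
    nlinarith
  intro η hη
  obtain ⟨K, hK, hKg⟩ := hg η hη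
  -- Replace `ψ` by a function of the increments outside of a neighbourhood of `0`.
  obtain ⟨n, hn⟩ : ∃ n, ∫ f, |ψ f - (μ[ψ | outerFiltration n]) f| ∂μ ≤ η := by
    have hlim := hψ.tendsto_eLpNorm_condExp (ℱ := outerFiltration) mψ'
    obtain ⟨n, hn⟩ := (hlim.eventually_lt_const (ENNReal.ofReal_pos.2 hη)).exists
    refine ⟨n, ?_⟩
    have hi : Integrable (μ[ψ | outerFiltration n] - ψ) μ := integrable_condExp.sub hψ
    rw [eLpNorm_one_eq_lintegral_enorm, ← ofReal_integral_norm_eq_lintegral_enorm hi,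
      ENNReal.ofReal_lt_ofReal_iff hη] at hn
    refine le_of_eq_of_le (integral_congr_ae (.of_forall fun f ↦ ?_)) hn.le
    exact abs_sub_comm _ _
  set φ := μ[ψ | outerFiltration n] with hφ
  have iφ : Integrable φ μ := integrable_condExp
  have hδ : ∀ᶠ ε in 𝓝[≠] (0 : ℝ), ε ^ 2 * K ≤ 1 / ((n : ℝ) + 1) := by
    have hc : Continuous fun ε : ℝ ↦ ε ^ 2 * K := by fun_prop
    have h0 := hc.tendsto 0
    simp only [ne_eq, OfNat.ofNat_ne_zero, not_false_eq_true, zero_pow, zero_mul] at h0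
    exact (h0.mono_left nhdsWithin_le_nhds).eventually_le_const (by positivity)
  filter_upwards [hδ, self_mem_nhdsWithin] with ε hε hε0
  have mR := measurable_rescaleAtZero ε
  have mgR : Measurable fun f ↦ g (rescaleAtZero ε f) := mg.comp mR
  have mgK : Measurable fun f ↦ g (stopAt K f) := mg.comp (measurable_stopAt K)
  have mgKR : Measurable fun f ↦ g (stopAt K (rescaleAtZero ε f)) := mgK.comp mR
  have hscale : ∫ f, g (stopAt K (rescaleAtZero ε f)) ∂μ = ∫ f, g (stopAt K f) ∂μ := by
    conv_rhs => rw [← map_rescaleAtZero hμ hε0]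
    rw [integral_map mR.aemeasurable mgK.aestronglyMeasurable]
  -- The main term factorizes by independence.
  have hmain : ∫ f, φ f * g (stopAt K (rescaleAtZero ε f)) ∂μ =
      (∫ f, ψ f ∂μ) * ∫ f, g (stopAt K f) ∂μ := by
    have hind := indepFun_stopAt_rescaleAtZero_outerIncrements hμ hK
      (δ := 1 / ((n : ℝ) + 1)) (by positivity) hε
    have hind' : IndepFun φ (fun f ↦ g (stopAt K (rescaleAtZero ε f))) μ := by
      rw [IndepFun_iff_Indep] at hind ⊢
      refine (indep_of_indep_of_le_left (indep_of_indep_of_le_right hind ?_) ?_).symm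
      · exact (stronglyMeasurable_condExp (m := outerFiltration n)).measurable.comap_le
      · exact (mg.comp (comap_measurable _)).comap_le
    rw [hind'.integral_fun_mul_eq_mul_integral iφ.aestronglyMeasurable mgKR.aestronglyMeasurable,
      hscale, hφ, integral_condExp (outerFiltration.le n)]
  have e1 : |∫ f, ψ f * g (rescaleAtZero ε f) ∂μ -
      ∫ f, ψ f * g (stopAt K (rescaleAtZero ε f)) ∂μ| ≤ (∫ f, |ψ f| ∂μ) * η := by
    rw [← integral_sub (hmul hψ mgR fun f ↦ hM _) (hmul hψ mgKR fun f ↦ hM _),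
      ← integral_mul_const]
    refine (abs_integral_le_integral_abs).trans (integral_mono_of_nonneg
      (.of_forall fun f ↦ abs_nonneg _) (hψ.abs.mul_const η) (.of_forall fun f ↦ ?_))
    simp only [← mul_sub, abs_mul]
    exact mul_le_mul_of_nonneg_left (hKg _) (abs_nonneg _)
  have e2 : |∫ f, ψ f * g (stopAt K (rescaleAtZero ε f)) ∂μ -
      ∫ f, φ f * g (stopAt K (rescaleAtZero ε f)) ∂μ| ≤ M * η := by
    rw [← integral_sub (hmul hψ mgKR fun f ↦ hM _) (hmul iφ mgKR fun f ↦ hM _)]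
    refine le_trans (b := ∫ f, M * |ψ f - φ f| ∂μ) (abs_integral_le_integral_abs.trans
      (integral_mono_of_nonneg (.of_forall fun f ↦ abs_nonneg _)
        ((hψ.sub iφ).abs.const_mul M) (.of_forall fun f ↦ ?_))) ?_
    · simp only [← sub_mul, abs_mul]
      rw [mul_comm]
      exact mul_le_mul_of_nonneg_right (hM _) (abs_nonneg _)
    · rw [integral_const_mul]
      exact mul_le_mul_of_nonneg_left hn hM0
  have e3 : |∫ f, g (stopAt K f) ∂μ - ∫ f, g f ∂μ| ≤ η := by
    rw [← integral_sub (hbdd mgK fun f ↦ hM _) (hbdd mg hM)]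
    have h := norm_integral_le_of_norm_le_const (μ := μ)
      (f := fun f ↦ g (stopAt K f) - g f) (C := η)
      (.of_forall fun f ↦ (abs_sub_comm _ _).trans_le (hKg f))
    rwa [probReal_univ, mul_one] at h
  have e4 : |(∫ f, ψ f ∂μ) * ∫ f, g (stopAt K f) ∂μ - (∫ f, ψ f ∂μ) * ∫ f, g f ∂μ| ≤
      (∫ f, |ψ f| ∂μ) * η := by
    rw [← mul_sub, abs_mul]
    exact mul_le_mul abs_integral_le_integral_abs e3 (abs_nonneg _)
      (integral_nonneg fun f ↦ abs_nonneg _)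
  rw [hmain] at e2
  rw [abs_le] at *
  constructor <;> linarith

/-! ### Convergence in law -/

/-- A uniformly continuous function is nearly local, because two paths are uniformly close for the
uniformity of compact convergence as soon as they agree on a large compact set. -/
lemma UniformContinuous.isNearlyLocal {g : C(ℝ, ℝ) → ℝ} (hg : UniformContinuous g) :
    IsNearlyLocal g := by
  intro η hη
  have h := hg (Metric.dist_mem_uniformity hη)
  obtain ⟨⟨C, V⟩, ⟨hC, hV⟩, hsub⟩ :=
    ContinuousMap.hasBasis_compactConvergenceUniformity.mem_iff.1 (mem_map.1 h)
  obtain ⟨K, hK⟩ := hC.isBounded.exists_norm_le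
  refine ⟨max K 0, le_max_right _ _, fun f ↦ ?_⟩
  have hmem : (f, stopAt (max K 0) f) ∈ {p : C(ℝ, ℝ) × C(ℝ, ℝ) | ∀ x ∈ C, (p.1 x, p.2 x) ∈ V} := by
    intro x hx
    have : stopAt (max K 0) f x = f x :=
      congrArg f (clampAt_of_abs_le ((hK x hx).trans (le_max_left _ _)))
    rw [this]
    exact refl_mem_uniformity hV
  exact le_of_lt (hsub hmem)

/-- Only the path on `[-1, 1]` matters for the rescaled path on a fixed compact interval, when `ε`
is small. -/
lemma stopAt_rescaleAtZero_stopCentred {K ε : ℝ} (hK : 0 ≤ K) (hε : ε ^ 2 * K ≤ 1)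
    (f : C(ℝ, ℝ)) :
    stopAt K (rescaleAtZero ε (stopCentred f)) = stopAt K (rescaleAtZero ε f) := by
  ext t
  have h : |ε ^ 2 * clampAt K t| ≤ 1 := by
    rw [abs_mul, abs_of_nonneg (sq_nonneg ε)]
    exact (mul_le_mul_of_nonneg_left (abs_clampAt_le hK t) (sq_nonneg ε)).trans hε
  change ε⁻¹ * (f (clampAt 1 (ε ^ 2 * clampAt K t)) - f 0 - (f (clampAt 1 0) - f 0)) =
    ε⁻¹ * (f (ε ^ 2 * clampAt K t) - f 0)
  rw [clampAt_of_abs_le h, clampAt_of_abs_le (K := 1) (t := 0) (by simp)]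
  ring

lemma stopCentred_recentre (f : C(ℝ, ℝ)) : stopCentred (recentre f) = stopCentred f := by
  ext t
  change f (clampAt 1 t) - f 0 - (f 0 - f 0) = f (clampAt 1 t) - f 0
  ring

/-- Absolute continuity on `[-1, 1]` with respect to Brownian motion suffices for the convergence
of the integrals of a nearly local function of the rescaled path. -/
lemma tendsto_integral_rescaleAtZero_of_absolutelyContinuous {v : ℝ≥0} {μ ν : Measure C(ℝ, ℝ)}
    [IsProbabilityMeasure ν]
    (hμ : IsCentredGaussian (fun (t : ℝ) (f : C(ℝ, ℝ)) ↦ f t)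
      (fun s t ↦ v * brownianKernel s t) μ)
    (hν : ν.map stopCentred ≪ μ.map stopCentred) {g : C(ℝ, ℝ) → ℝ} (mg : Measurable g) {M : ℝ}
    (hM : ∀ f, |g f| ≤ M) (hg : IsNearlyLocal g) :
    Tendsto (fun ε ↦ ∫ f, g (rescaleAtZero ε f) ∂ν) (𝓝[≠] 0) (𝓝 (∫ f, g f ∂μ)) := by
  have := hμ.gaussian.isProbabilityMeasure
  have mS := measurable_stopCentred
  have := Measure.isProbabilityMeasure_map (μ := ν) mS.aemeasurable
  have := Measure.isProbabilityMeasure_map (μ := μ) mS.aemeasurable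
  let ρ : C(ℝ, ℝ) → ℝ := fun h ↦ ((ν.map stopCentred).rnDeriv (μ.map stopCentred) h).toReal
  let ψ : C(ℝ, ℝ) → ℝ := fun f ↦ ρ (stopCentred f)
  have mρ : Measurable ρ := (Measure.measurable_rnDeriv _ _).ennreal_toReal
  have iψ : Integrable ψ μ :=
    (Measure.integrable_toReal_rnDeriv (μ := ν.map stopCentred)).comp_measurable mS
  have hρ {h : C(ℝ, ℝ) → ℝ} (mh : Measurable h) :
      ∫ f, ψ f * h (stopCentred f) ∂μ = ∫ f, h (stopCentred f) ∂ν := by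
    have h1 := integral_rnDeriv_smul (f := h) hν
    rw [integral_map mS.aemeasurable mh.aestronglyMeasurable] at h1
    rw [← h1]
    exact (integral_map mS.aemeasurable (mρ.mul mh).aestronglyMeasurable).symm
  have hψ1 : ∫ f, ψ f ∂μ = 1 := by
    have := hρ (h := fun _ ↦ 1) measurable_const
    simpa using this
  have hψ0 (f : C(ℝ, ℝ)) : 0 ≤ ψ f := ENNReal.toReal_nonneg
  have hmix := tendsto_integral_mul_rescaleAtZero hμ iψ (mρ.comp mS)
    (fun f ↦ congrArg ρ (stopCentred_recentre f)) mg hM hg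
  rw [hψ1, one_mul] at hmix
  refine hmix.congr_dist (Metric.tendsto_nhds.2 fun e he ↦ ?_)
  obtain ⟨K, hK, hKg⟩ := hg (e / 3) (by positivity)
  have hδ : ∀ᶠ ε in 𝓝[≠] (0 : ℝ), ε ^ 2 * K ≤ 1 := by
    have hc : Continuous fun ε : ℝ ↦ ε ^ 2 * K := by fun_prop
    have h0 := hc.tendsto 0
    simp only [ne_eq, OfNat.ofNat_ne_zero, not_false_eq_true, zero_pow, zero_mul] at h0
    exact (h0.mono_left nhdsWithin_le_nhds).eventually_le_const one_pos
  filter_upwards [hδ] with ε hε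
  have mR := measurable_rescaleAtZero ε
  have mgR : Measurable fun f ↦ g (rescaleAtZero ε f) := mg.comp mR
  have mgKR : Measurable fun f ↦ g (stopAt K (rescaleAtZero ε f)) :=
    mg.comp ((measurable_stopAt K).comp mR)
  have hmul {h : C(ℝ, ℝ) → ℝ} (mh : Measurable h) (hh : ∀ f, |h f| ≤ M) :
      Integrable (fun f ↦ ψ f * h f) μ :=
    iψ.mul_bdd (c := M) mh.aestronglyMeasurable (.of_forall hh)
  have hbdd {h : C(ℝ, ℝ) → ℝ} (mh : Measurable h) (hh : ∀ f, |h f| ≤ M) : Integrable h ν :=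
    .of_bound mh.aestronglyMeasurable M (.of_forall hh)
  have heq : ∫ f, ψ f * g (stopAt K (rescaleAtZero ε f)) ∂μ =
      ∫ f, g (stopAt K (rescaleAtZero ε f)) ∂ν := by
    simpa only [stopAt_rescaleAtZero_stopCentred hK hε] using hρ mgKR
  have e1 : |∫ f, ψ f * g (rescaleAtZero ε f) ∂μ -
      ∫ f, ψ f * g (stopAt K (rescaleAtZero ε f)) ∂μ| ≤ e / 3 := by
    rw [← integral_sub (hmul mgR fun f ↦ hM _) (hmul mgKR fun f ↦ hM _)]
    refine (abs_integral_le_integral_abs).trans ((integral_mono_of_nonneg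
      (.of_forall fun f ↦ abs_nonneg _) (iψ.mul_const (e / 3)) (.of_forall fun f ↦ ?_)).trans ?_)
    · simp only [← mul_sub, abs_mul, abs_of_nonneg (hψ0 f)]
      exact mul_le_mul_of_nonneg_left (hKg _) (hψ0 f)
    · rw [integral_mul_const, hψ1, one_mul]
  have e2 : |∫ f, g (rescaleAtZero ε f) ∂ν - ∫ f, g (stopAt K (rescaleAtZero ε f)) ∂ν| ≤ e / 3 := by
    rw [← integral_sub (hbdd mgR fun f ↦ hM _) (hbdd mgKR fun f ↦ hM _)]
    have h := norm_integral_le_of_norm_le_const (μ := ν)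
      (f := fun f ↦ g (rescaleAtZero ε f) - g (stopAt K (rescaleAtZero ε f)))
      (.of_forall fun f ↦ hKg _)
    rwa [probReal_univ, mul_one] at h
  rw [heq] at e1
  rw [Real.dist_eq, sub_zero, Real.dist_eq, abs_of_nonneg (abs_nonneg _)]
  rw [abs_le] at e1 e2
  rw [abs_lt]
  constructor <;> linarith

theorem mainTheorem6 (v : ℝ≥0) (hv : 0 < v) {Ω : Type*} [MeasurableSpace Ω] (P : Measure Ω)
    [IsProbabilityMeasure P] (F : Ω → C(ℝ, ℝ)) (hF : Measurable F)
    (hB : BrownianOnCompacts v P F) :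
    WeaklyLocallyBrownian v P F := by
  obtain ⟨m, hm, hac⟩ := hB (-1) 1 (by norm_num)
  have hext := hm.isCentredGaussian_extendCentred
  let μ : Measure C(ℝ, ℝ) := (m.map extendCentred).map unfoldBridges
  have hμ : IsCentredGaussian (fun (t : ℝ) (f : C(ℝ, ℝ)) ↦ f t)
    (fun s t ↦ v * brownianKernel s t) μ := isCentredGaussian_unfoldBridges hext
  have hμP : IsProbabilityMeasure μ := hμ.gaussian.isProbabilityMeasure
  -- Both laws are those of two-sided Brownian motion frozen outside of `[-1, 1]`.
  have hlaw : m.map extendCentred = μ.map stopCentred := by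
    have := map_eq_of_isCentredGaussian measurable_id measurable_id hext
      (isCentredGaussian_stopCentred hμ)
    simpa only [Measure.map_id] using this
  have := Measure.isProbabilityMeasure_map (μ := P) hF.aemeasurable
  have hac' : (P.map F).map stopCentred ≪ μ.map stopCentred := by
    rw [← hlaw, Measure.map_map measurable_stopCentred hF]
    have hinc : Measurable fun ω ↦ incrementOn (-1) 1 (F ω) := (measurable_incrementOn _ _).comp hF
    have := hac.map measurable_extendCentred
    rw [Measure.map_map measurable_extendCentred hinc] at this
    convert this using 2
    funext ω
    exact (extendCentred_incrementOn (F ω)).symm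
  have hmeas (ε : ℝ) : Measurable fun ω ↦ rescaleAtZero ε (F ω) :=
    (measurable_rescaleAtZero ε).comp hF
  suffices h : TendstoInDistribution (fun (ε : ℝ) (ω : Ω) ↦ rescaleAtZero ε (F ω)) (𝓝[≠] 0)
      (id : C(ℝ, ℝ) → C(ℝ, ℝ)) (fun _ ↦ P) μ from
    ⟨⟨μ, hμP⟩, isTwoSidedBrownianLaw_of_isCentredGaussian hμ, h⟩
  refine ⟨fun ε ↦ (hmeas ε).aemeasurable, aemeasurable_id, ?_⟩
  -- A metric inducing the uniformity of compact convergence, so that Lipschitz functions are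
  -- nearly local.
  let _ : PseudoMetricSpace C(ℝ, ℝ) := UniformSpace.pseudoMetricSpace C(ℝ, ℝ)
  refine tendsto_iff_forall_lipschitz_integral_tendsto.2 ?_
  rintro g ⟨C, hC⟩ ⟨L, hL⟩
  have hgm : Measurable g := hL.continuous.measurable
  have hM (f : C(ℝ, ℝ)) : |g f| ≤ C + |g 0| := by
    have h1 := hC f 0
    rw [Real.dist_eq] at h1
    have h2 := abs_sub_abs_le_abs_sub (g f) (g 0)
    linarith
  have key := tendsto_integral_rescaleAtZero_of_absolutelyContinuous hμ hac' hgm hM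
    hL.uniformContinuous.isNearlyLocal
  simp only [ProbabilityMeasure.coe_mk, Measure.map_id]
  refine key.congr fun ε ↦ ?_
  have hgR : Measurable fun f ↦ g (rescaleAtZero ε f) := hgm.comp (measurable_rescaleAtZero ε)
  rw [integral_map hF.aemeasurable hgR.aestronglyMeasurable,
    integral_map (hmeas ε).aemeasurable hgm.aestronglyMeasurable]
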